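/- Let $k$ be an algebraically closed field of characteristic zero. For a commutative $k$-algebra $R$ and an integer $n\ge 1$, let $I$ be the kernel of the multiplication map $R\otimes_k R\to R$, and let $\Omega_n(R)=I/I^{n+1}$ be the universal module of $n$-th order $k$-derivations of $R$, regarded as an $R$-module through the left tensor factor, with universal derivation $d_n\colon R\to\Omega_n(R)$, $d_n(r)=1\otimes r-r\otimes 1+I^{n+1}$. When $R$ is local with maximal ideal $\mathfrak n$, the Betti series of $\Omega_n(R)$ is $$B(\Omega_n(R),t)=\sum_{i\ge 0}\dim_{R/\mathfrak n}\operatorname{Ext}^i_R\bigl(\Omega_n(R),R/\mathfrak n\bigr)\,t^i .$$ **Theorem.** Let $n\ge 1$, let $S=k[x_1,\dots,x_s]$ be a polynomial algebra, and let $m$ be a maximal ideal of $S$ containing an irreducible element $f$. Assume that $$d_n\bigl(x_1^{\alpha_1}\cdots x_s^{\alpha_s}f\bigr)\in m\,\Omega_n(S)\qquad\text{whenever } 0\le \alpha_1+\cdots+\alpha_s\le n-1 .$$ Let $R=S/(f)$ and $\bar m=m/(f)$, and assume that the local ring $R_{\bar m}$ is not regular. Then the vector spaces $\operatorname{Ext}^i_{R_{\bar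 m}}(\Omega_n(R_{\bar m}),R_{\bar m}/\bar mR_{\bar m})$ are finite-dimensional over $R_{\bar m}/\bar mR_{\bar m}$ for all $i\ge 0$, and the Betti series $B(\Omega_n(R_{\bar m}),t)$ is a rational function; in fact it is a polynomial in $t$ of degree at most $1$. -/

import Mathlib

open scoped TensorProduct

universe u v

/-! ### Universal modules of higher order derivations -/

section UniversalModule

variable (k : Type u) (R : Type v) [CommRing k] [CommRing R] [Algebra k R] (n : ℕ)

/-- The module `Ω_n(R) = I / I ^ (n + 1)` of `n`-th order `k`-derivations of `R`, where `I` is the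
kernel of the multiplication map `R ⊗[k] R → R`. -/
def UniversalModule : Type v :=
  (KaehlerDifferential.ideal k R) ⧸
    Submodule.comap (KaehlerDifferential.ideal k R).subtype (KaehlerDifferential.ideal k R ^ (n + 1))

namespace UniversalModule

noncomputable instance : AddCommGroup (UniversalModule k R n) :=
  inferInstanceAs (AddCommGroup (_ ⧸ Submodule.comap (KaehlerDifferential.ideal k R).subtype
    (KaehlerDifferential.ideal k R ^ (n + 1))))

noncomputable instance : Module (R ⊗[k] R) (UniversalModule k R n) :=
  inferInstanceAs (Module (R ⊗[k] R) (_ ⧸ Submodule.comap (KaehlerDifferential.ideal k R).subtype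
    (KaehlerDifferential.ideal k R ^ (n + 1))))

/-- The `R`-module structure: `r` acts as multiplication by `r ⊗ 1`. -/
noncomputable instance : Module R (UniversalModule k R n) :=
  Module.compHom (UniversalModule k R n)
    (Algebra.TensorProduct.includeLeftRingHom : R →+* R ⊗[k] R)

instance : IsScalarTower R (R ⊗[k] R) (UniversalModule k R n) where
  smul_assoc r x y := by
    rw [Algebra.smul_def, mul_smul]
    rfl

/-- The quotient map `I → I / I ^ (n + 1)`. -/
noncomputable def mk : KaehlerDifferential.ideal k R →ₗ[R ⊗[k] R] UniversalModule k R n :=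
  Submodule.mkQ _

/-- The universal `n`-th order derivation `d_n(r) = 1 ⊗ r - r ⊗ 1 + I ^ (n + 1)`. -/
noncomputable def d (r : R) : UniversalModule k R n :=
  mk k R n ⟨(1 : R) ⊗ₜ[k] r - r ⊗ₜ[k] (1 : R),
    KaehlerDifferential.one_smul_sub_smul_one_mem_ideal k r⟩

end UniversalModule

end UniversalModule

/-! ### Betti series over a local ring -/

section Betti

open CategoryTheory

variable (A : Type u) [CommRing A] [IsLocalRing A] (M : Type u) [AddCommGroup M] [Module A M]

/-- `Ext^i_A(M, A/m)`, where `A/m` is the residue field of the local ring `A`. -/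
abbrev ResidueExt (i : ℕ) : Type u :=
  Abelian.Ext (ModuleCat.of A M) (ModuleCat.of A (IsLocalRing.ResidueField A)) i

theorem residueExt_isTorsionBySet (i : ℕ) :
    Module.IsTorsionBySet A (ResidueExt A M i) (IsLocalRing.maximalIdeal A) := by
  rintro x ⟨a, ha⟩
  have h0 : a • 𝟙 (ModuleCat.of A (IsLocalRing.ResidueField A)) = 0 := by
    ext y
    change a • y = 0
    rw [Algebra.smul_def, IsLocalRing.ResidueField.algebraMap_eq,
      (IsLocalRing.residue_eq_zero_iff a).2 ha, zero_mul]
  change a • x = 0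
  rw [Abelian.Ext.smul_eq_comp_mk₀, h0, Abelian.Ext.mk₀_zero, Abelian.Ext.comp_zero]

/-- `Ext^i_A(M, A/m)` as a vector space over `A/m`: its `A`-module structure factors through the
residue field. -/
noncomputable instance residueExtModule (i : ℕ) :
    Module (IsLocalRing.ResidueField A) (ResidueExt A M i) :=
  (residueExt_isTorsionBySet A M i).module

/-- The Betti series `∑ dim_{A/m} Ext^i_A(M, A/m) t^i`; it is meaningful when all these vector
spaces are finite-dimensional. -/
noncomputable def bettiSeries : PowerSeries ℚ :=
  PowerSeries.mk fun i =>
    (Module.finrank (IsLocalRing.ResidueField A) (ResidueExt A M i) : ℚ)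

end Betti

/-- A power series over `ℚ` is (the expansion of) a rational function. -/
def IsRationalSeries (B : PowerSeries ℚ) : Prop :=
  ∃ P Q : Polynomial ℚ, Q ≠ 0 ∧ (Q : PowerSeries ℚ) * B = (P : PowerSeries ℚ)

/-! ### The local ring of a hypersurface at a maximal ideal -/

section Hypersurface

variable {S : Type u} [CommRing S]

/-- The ideal `m / (f)` of `S / (f)`. -/
abbrev quotientIdeal (f : S) (m : Ideal S) : Ideal (S ⧸ Ideal.span {f}) :=
  m.map (Ideal.Quotient.mk (Ideal.span {f}))

theorem quotientIdeal_isPrime {f : S} {m : Ideal S} [m.IsPrime] (hf : f ∈ m) :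
    (quotientIdeal f m).IsPrime :=
  Ideal.map_isPrime_of_surjective Ideal.Quotient.mk_surjective
    (by rw [Ideal.mk_ker]; exact (Ideal.span_singleton_le_iff_mem m).2 hf)

/-- The localization of `S / (f)` at `m / (f)`, for a prime ideal `m` of `S` containing `f`. -/
abbrev HypersurfaceLocalRing (f : S) (m : Ideal S) [m.IsPrime] (hf : f ∈ m) : Type u :=
  @Localization.AtPrime (S ⧸ Ideal.span {f}) _ (quotientIdeal f m) (quotientIdeal_isPrime hf)

end Hypersurface

/-! Write `A` for the local ring of the hypersurface and `F = f(x + Y)` in `A[Y]` for the Taylor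
expansion of `f`. Sending `Y_i` to `1 ⊗ x_i - x_i ⊗ 1` identifies the principal parts `A ⊗ A / I ^
(n + 1)` with `A[Y] / ((Y) ^ (n + 1) + (F))` (`taylorQuotientEquiv`). Since `f` vanishes in `A`, `F`
has no constant term, so multiplication by `F` gives a complex `0 → A[Y] / (Y) ^ n → A[Y] / (Y) ^ (n
+ 1) → P_n(A) → 0` whose first two modules are finite free.

Only injectivity on the left is delicate. In characteristic zero an irreducible `f` fails to divide
some partial derivative (`exists_not_dvd_pderiv`), so `F` has a nonzero linear coefficient. As `A`
is a domain, orders add under multiplication, and `F` has order exactly one (`mulTaylor_injective`).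

Thus `P_n(A)`, and with it its direct summand `Ω_n(A)`, has projective dimension at most one. The
groups `Ext^i` vanish for `i ≥ 2`, and all are finite because `A` is noetherian and `Ω_n(A)` is
finite. -/

namespace MvPolynomial

/-! ### Taylor expansion of polynomials. -/

section Translation

variable {σ : Type*} (k : Type*) [CommRing k] (A : Type*) [CommRing A] [Algebra k A]
  [Algebra (MvPolynomial σ k) A]

/-- The Taylor expansion `p ↦ p(x + Y)`, with values in `A[Y]`. -/
noncomputable def taylorExpansion : MvPolynomial σ k →ₐ[k] MvPolynomial σ A :=
  aeval fun i => C (algebraMap (MvPolynomial σ k) A (X i)) + X i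

@[simp]
theorem taylorExpansion_X (i : σ) :
    taylorExpansion k A (X i) = C (algebraMap (MvPolynomial σ k) A (X i)) + X i := by
  simp [taylorExpansion]

variable [IsScalarTower k (MvPolynomial σ k) A]

theorem taylorExpansion_C (a : k) :
    taylorExpansion k A (C a : MvPolynomial σ k) =
      C (algebraMap (MvPolynomial σ k) A (C a)) := by
  rw [← algebraMap_eq, AlgHom.commutes, ← IsScalarTower.algebraMap_apply k (MvPolynomial σ k) A]
  rfl

theorem coeff_zero_taylorExpansion (p : MvPolynomial σ k) :
    coeff 0 (taylorExpansion k A p) = algebraMap (MvPolynomial σ k) A p := by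
  induction p using MvPolynomial.induction_on with
  | C a => rw [taylorExpansion_C, coeff_zero_C]
  | add p q hp hq => simp [hp, hq]
  | mul_X p i hp =>
    rw [map_mul, map_mul, taylorExpansion_X, ← constantCoeff_eq, map_mul, constantCoeff_eq, hp]
    simp

theorem coeff_single_taylorExpansion (p : MvPolynomial σ k) (j : σ) :
    coeff (Finsupp.single j 1) (taylorExpansion k A p) =
      algebraMap (MvPolynomial σ k) A (pderiv j p) := by
  classical
  induction p using MvPolynomial.induction_on with
  | C a => rw [taylorExpansion_C, pderiv_C, map_zero, coeff_C, if_neg (by simp [eq_comm])]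
  | add p q hp hq => simp [hp, hq]
  | mul_X p i hp =>
    rw [map_mul, taylorExpansion_X, mul_add, coeff_add, mul_comm _ (C _), coeff_C_mul, hp,
      coeff_mul_X', Derivation.leibniz, pderiv_X]
    by_cases h : i = j
    · subst h
      simp [coeff_zero_taylorExpansion, add_comm]
    · simp [h]

theorem taylorExpansion_sub_C_mem (p : MvPolynomial σ k) :
    taylorExpansion k A p - C (algebraMap (MvPolynomial σ k) A p) ∈ idealOfVars σ A := by
  rw [← pow_one (idealOfVars σ A), mem_pow_idealOfVars_iff']
  intro x hx
  obtain rfl : x = 0 := (Finsupp.degree_eq_zero_iff x).1 (Nat.lt_one_iff.1 hx)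
  simp [coeff_zero_taylorExpansion]

end Translation

/-! ### Order of vanishing in `Y` and the truncations `A[Y] / (Y) ^ n`. -/

section Order

variable {σ A : Type*} [CommRing A]

theorem mem_pow_idealOfVars_iff_le_order (n : ℕ) (p : MvPolynomial σ A) :
    p ∈ idealOfVars σ A ^ n ↔ (n : ℕ∞) ≤ (p : MvPowerSeries σ A).order := by
  rw [mem_pow_idealOfVars_iff']
  refine ⟨fun h => MvPowerSeries.nat_le_order fun d hd => ?_, fun h x hx => ?_⟩
  · rw [coeff_coe]; exact h d hd
  · rw [← coeff_coe]
    exact MvPowerSeries.coeff_of_lt_order (lt_of_lt_of_le (by exact_mod_cast hx) h)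

/-- Multiplication by a polynomial with a nonzero linear form raises the order by at most one. -/
theorem mem_pow_idealOfVars_of_mul_mem [IsDomain A] {F g : MvPolynomial σ A} {j : σ} {n : ℕ}
    (hF : coeff (Finsupp.single j 1) F ≠ 0) (h : F * g ∈ idealOfVars σ A ^ (n + 1)) :
    g ∈ idealOfVars σ A ^ n := by
  rw [mem_pow_idealOfVars_iff_le_order] at h ⊢
  -- Orders add because `A` is a domain; the monomial `Y_j` bounds the order of `F` by one.
  rw [coe_mul, MvPowerSeries.order_mul] at h
  have h1 : (F : MvPowerSeries σ A).order ≤ 1 := by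
    have := MvPowerSeries.order_le (f := (F : MvPowerSeries σ A)) (d := Finsupp.single j 1)
      (by rwa [coeff_coe])
    simpa using this
  have h2 : ((n + 1 : ℕ) : ℕ∞) ≤ 1 + (g : MvPowerSeries σ A).order :=
    h.trans (add_le_add_left h1 _)
  rw [Nat.cast_add, Nat.cast_one, add_comm] at h2
  exact (ENat.add_le_add_iff_left (by simp)).1 h2

variable (σ A)

/-- The monomials of degree less than `n` form a basis of `A[Y] / (Y) ^ n`. -/
noncomputable def quotientPowIdealOfVarsEquiv (n : ℕ) :
    ({x : σ →₀ ℕ // x.degree < n} →₀ A) ≃ₗ[A] MvPolynomial σ A ⧸ idealOfVars σ A ^ n :=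
  LinearEquiv.ofBijective
    (Finsupp.linearCombination A fun x : {x : σ →₀ ℕ // x.degree < n} =>
      Ideal.Quotient.mk (idealOfVars σ A ^ n) (monomial x.1 1)) <| by
  classical
  have key (c : {x : σ →₀ ℕ // x.degree < n} →₀ A) :
      Finsupp.linearCombination A (fun x : {x : σ →₀ ℕ // x.degree < n} =>
        Ideal.Quotient.mk (idealOfVars σ A ^ n) (monomial x.1 1)) c =
      Ideal.Quotient.mk (idealOfVars σ A ^ n) (c.sum fun x a => monomial x.1 a) := by
    rw [Finsupp.linearCombination_apply, Finsupp.sum, Finsupp.sum, map_sum]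
    refine Finset.sum_congr rfl fun x _ => ?_
    rw [← Ideal.Quotient.mkₐ_eq_mk A, ← map_smul, smul_monomial, smul_eq_mul, mul_one]
  constructor
  · rw [← LinearMap.ker_eq_bot, LinearMap.ker_eq_bot']
    intro c hc
    rw [key, Ideal.Quotient.eq_zero_iff_mem, mem_pow_idealOfVars_iff'] at hc
    ext x
    have := hc x.1 x.2
    rw [Finsupp.sum, coeff_sum] at this
    simpa [coeff_monomial, Subtype.val_inj] using this
  · intro q
    obtain ⟨p, rfl⟩ := Ideal.Quotient.mk_surjective q
    induction p using MvPolynomial.induction_on' with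
    | monomial x a =>
      by_cases hx : x.degree < n
      · exact ⟨Finsupp.single ⟨x, hx⟩ a, by rw [key]; simp⟩
      · refine ⟨0, ?_⟩
        rw [map_zero, eq_comm, Ideal.Quotient.eq_zero_iff_mem, mem_pow_idealOfVars_iff']
        intro y hy
        rw [coeff_monomial, if_neg]
        rintro rfl
        exact hx hy
    | add p q hp hq =>
      obtain ⟨a, ha⟩ := hp
      obtain ⟨b, hb⟩ := hq
      exact ⟨a + b, by rw [map_add, map_add, ha, hb]⟩

instance free_quotient_pow_idealOfVars (n : ℕ) :
    Module.Free A (MvPolynomial σ A ⧸ idealOfVars σ A ^ n) :=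
  Module.Free.of_equiv (quotientPowIdealOfVarsEquiv σ A n)

instance finite_quotient_pow_idealOfVars [Finite σ] (n : ℕ) :
    Module.Finite A (MvPolynomial σ A ⧸ idealOfVars σ A ^ n) :=
  have : Finite {x : σ →₀ ℕ // x.degree < n} :=
    (Finsupp.finite_of_degree_lt (σ := σ) n).to_subtype
  Module.Finite.equiv (quotientPowIdealOfVarsEquiv σ A n)

end Order

/-! ### Partial derivatives in characteristic zero. -/

section Derivative

theorem exists_pderiv_ne_zero {σ k : Type*} [Field k] [CharZero k] {f : MvPolynomial σ k}
    (hf : f.totalDegree ≠ 0) : ∃ j, pderiv j f ≠ 0 := by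
  classical
  obtain ⟨d, hd, hd0⟩ : ∃ d ∈ f.support, d ≠ 0 := by
    by_contra! h
    exact hf (by rw [totalDegree_eq_zero_iff]; intro m hm x; simp [h m hm])
  obtain ⟨j, hj⟩ := Finsupp.ne_iff.1 hd0
  refine ⟨j, fun h => ?_⟩
  have h1 : Finsupp.single j 1 ≤ d := by
    simpa [Nat.one_le_iff_ne_zero] using hj
  have h2 := congrArg (coeff (d - Finsupp.single j 1)) h
  rw [coeff_pderiv, tsub_add_cancel_of_le h1, coeff_zero, mul_eq_zero] at h2
  rcases h2 with h2 | h2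
  · exact mem_support_iff.1 hd h2
  · exact Nat.cast_add_one_ne_zero _ h2

/-- An irreducible `f` is not constant, so some derivative is nonzero; its total degree is smaller
than that of `f`, which excludes divisibility. -/
theorem exists_not_dvd_pderiv {σ k : Type*} [Field k] [CharZero k] {f : MvPolynomial σ k}
    (hf : Irreducible f) : ∃ j, ¬ f ∣ pderiv j f := by
  classical
  have hdeg : f.totalDegree ≠ 0 := by
    intro h
    rw [totalDegree_eq_zero_iff_eq_C] at h
    refine hf.not_isUnit ?_
    have : coeff 0 f ≠ 0 := fun h0 => hf.ne_zero (by rw [h, h0, C_0])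
    rw [h]
    exact (IsUnit.mk0 _ this).map C
  obtain ⟨j, hj⟩ := exists_pderiv_ne_zero hdeg
  refine ⟨j, fun ⟨g, hg⟩ => ?_⟩
  have hg0 : g ≠ 0 := by rintro rfl; exact hj (by simpa using hg)
  have h1 : f.totalDegree ≤ (pderiv j f).totalDegree := by
    rw [hg, totalDegree_mul_of_isDomain hf.ne_zero hg0]
    exact Nat.le_add_right _ _
  have h2 : (pderiv j f).totalDegree + 1 ≤ f.totalDegree := by
    obtain ⟨d, hd, hd'⟩ := Finset.exists_mem_eq_sup _ (support_nonempty.2 hj) fun s : σ →₀ ℕ =>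
      s.sum fun _ e => e
    have h3 : d + Finsupp.single j 1 ∈ f.support := by
      rw [mem_support_iff, coeff_pderiv] at hd
      exact mem_support_iff.2 fun h => hd (by rw [h, zero_mul])
    have h4 := le_totalDegree h3
    rw [Finsupp.sum_add_index' (by simp) (by simp)] at h4
    rw [totalDegree, hd']
    simpa using h4
  omega

end Derivative

end MvPolynomial

/-! ### Principal parts and the summand `Ω_n`. -/

section PrincipalParts

variable (k A : Type*) [CommRing k] [CommRing A] [Algebra k A] (n : ℕ)

/-- The algebra `A ⊗ A / I ^ (n + 1)` of principal parts of order `n`. -/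
abbrev PrincipalParts : Type _ := (A ⊗[k] A) ⧸ KaehlerDifferential.ideal k A ^ (n + 1)

namespace PrincipalParts

/-- The algebra homomorphism `a ↦ 1 ⊗ a`. -/
noncomputable def inr : A →ₐ[k] PrincipalParts k A n :=
  (Ideal.Quotient.mkₐ k _).comp Algebra.TensorProduct.includeRight

variable {k A n}

theorem algHom_ext {B : Type*} [CommRing B] [Algebra A B] [Algebra k B] [IsScalarTower k A B]
    {φ ψ : PrincipalParts k A n →ₐ[A] B} (h : ∀ a, φ (inr k A n a) = ψ (inr k A n a)) :
    φ = ψ := by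
  refine Ideal.Quotient.algHom_ext _ (Algebra.TensorProduct.ext (by ext) ?_)
  ext a
  exact h a

end PrincipalParts

namespace UniversalModule

/-- The inclusion `I / I ^ (n + 1) → A ⊗ A / I ^ (n + 1)`. -/
noncomputable def toPrincipalParts : UniversalModule k A n →ₗ[A] PrincipalParts k A n where
  toFun := Submodule.mapQ
    (Submodule.comap (KaehlerDifferential.ideal k A).subtype (KaehlerDifferential.ideal k A ^ (n + 1)))
    (KaehlerDifferential.ideal k A ^ (n + 1)) (KaehlerDifferential.ideal k A).subtype le_rfl
  map_add' := map_add _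
  map_smul' a x := (LinearMap.map_smul (Submodule.mapQ
    (Submodule.comap (KaehlerDifferential.ideal k A).subtype (KaehlerDifferential.ideal k A ^ (n + 1)))
    (KaehlerDifferential.ideal k A ^ (n + 1)) (KaehlerDifferential.ideal k A).subtype le_rfl)
    (a ⊗ₜ[k] (1 : A)) x).trans (algebraMap_smul (A ⊗[k] A) a (_ : PrincipalParts k A n))

/-- The projection `x ↦ x - μ(x) ⊗ 1` of `A ⊗ A` to the augmentation ideal. -/
noncomputable def tensorProjection : A ⊗[k] A →ₗ[A] KaehlerDifferential.ideal k A :=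
  LinearMap.codRestrict ((KaehlerDifferential.ideal k A).restrictScalars A)
    (LinearMap.id - (Algebra.linearMap A (A ⊗[k] A)).comp
      (Algebra.TensorProduct.lmul'' k (S := A)).toLinearMap) <| fun x => by
    have h : Algebra.TensorProduct.lmul' k (S := A) x = Algebra.TensorProduct.lmul'' k x := rfl
    simp [KaehlerDifferential.ideal, RingHom.mem_ker, h]

variable {k A} in
theorem tensorProjection_of_mem (x : KaehlerDifferential.ideal k A) :
    tensorProjection k A x = x := by
  have h : Algebra.TensorProduct.lmul'' k (S := A) x = 0 := x.2
  refine Subtype.ext ?_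
  change (x : A ⊗[k] A) - algebraMap A (A ⊗[k] A) (Algebra.TensorProduct.lmul'' k (S := A) x) = x
  rw [h, map_zero, sub_zero]

/-- The projection of the principal parts onto the universal module. -/
noncomputable def ofPrincipalParts : PrincipalParts k A n →ₗ[A] UniversalModule k A n :=
  Submodule.liftQ ((KaehlerDifferential.ideal k A ^ (n + 1)).restrictScalars A)
    (((mk k A n).restrictScalars A).comp (tensorProjection k A)) fun x hx => by
      have hx' : x ∈ KaehlerDifferential.ideal k A ^ (n + 1) := hx
      have := tensorProjection_of_mem (k := k) ⟨x, Ideal.pow_le_self (Nat.succ_ne_zero n) hx'⟩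
      simp only at this
      rw [LinearMap.mem_ker, LinearMap.comp_apply, this]
      exact (Submodule.Quotient.mk_eq_zero _).2 hx'

/-- This splitting makes `Ω_n` a direct summand of the principal parts, so finiteness and bounds on
projective dimension pass to it. -/
theorem ofPrincipalParts_comp_toPrincipalParts :
    ofPrincipalParts k A n ∘ₗ toPrincipalParts k A n = LinearMap.id := by
  ext x
  obtain ⟨x, rfl⟩ := Submodule.mkQ_surjective _ x
  exact congrArg (mk k A n) (tensorProjection_of_mem x)

end UniversalModule

end PrincipalParts

/-! ### Taylor presentation of the principal parts of a localized hypersurface. -/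

section Hypersurface

open MvPolynomial

variable {σ k : Type*} [CommRing k] (f : MvPolynomial σ k) (A : Type*) [CommRing A] [Algebra k A]
  [Algebra (MvPolynomial σ k) A] [IsScalarTower k (MvPolynomial σ k) A] (n : ℕ)

/-- The ideal `(Y) ^ (n + 1) + (f(x + Y))` of `A[Y]`. -/
noncomputable def taylorIdeal : Ideal (MvPolynomial σ A) :=
  idealOfVars σ A ^ (n + 1) ⊔ Ideal.span {taylorExpansion k A f}

/-- The evaluation `Y_i ↦ 1 ⊗ x_i - x_i ⊗ 1`. -/
noncomputable def evalPrincipalParts : MvPolynomial σ A →ₐ[A] PrincipalParts k A n :=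
  aeval fun i => PrincipalParts.inr k A n (algebraMap (MvPolynomial σ k) A (X i)) -
    algebraMap A _ (algebraMap (MvPolynomial σ k) A (X i))

theorem evalPrincipalParts_taylorExpansion (p : MvPolynomial σ k) :
    evalPrincipalParts A n (taylorExpansion k A p) =
      PrincipalParts.inr k A n (algebraMap (MvPolynomial σ k) A p) := by
  suffices h : ((evalPrincipalParts A n).restrictScalars k).comp (taylorExpansion k A) =
      (PrincipalParts.inr k A n).comp (IsScalarTower.toAlgHom k (MvPolynomial σ k) A) from
    DFunLike.congr_fun h p
  ext i
  simp [evalPrincipalParts]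

-- Each `Y_i` lands in the image of `I`, whose power `n + 1` is zero, and `F` lands on the class of
-- `1 ⊗ f = 0`.
variable {f A} in
theorem taylorIdeal_le_ker (hf : algebraMap (MvPolynomial σ k) A f = 0) :
    taylorIdeal f A n ≤ RingHom.ker (evalPrincipalParts (σ := σ) (k := k) A n) := by
  refine sup_le ?_ ?_
  · have h : idealOfVars σ A ≤ ((KaehlerDifferential.ideal k A).map (Ideal.Quotient.mk
        (KaehlerDifferential.ideal k A ^ (n + 1)))).comap (evalPrincipalParts (k := k) A n) := by
      rw [idealOfVars, Ideal.span_le]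
      rintro _ ⟨i, rfl⟩
      simp only [SetLike.mem_coe, Ideal.mem_comap, evalPrincipalParts, aeval_X]
      exact Ideal.mem_map_of_mem _ (KaehlerDifferential.one_smul_sub_smul_one_mem_ideal k
        (algebraMap (MvPolynomial σ k) A (X i)))
    refine (Ideal.pow_right_mono h _).trans ((Ideal.le_comap_pow _ _).trans ?_)
    rw [← Ideal.map_pow, Ideal.map_quotient_self]
    exact le_rfl
  · rw [Ideal.span_singleton_le_iff_mem, RingHom.mem_ker, evalPrincipalParts_taylorExpansion, hf,
      map_zero]

/-- A unit plus a nilpotent is a unit, so the Taylor expansion inverts the elements of `M` and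
extends to the localization. -/
theorem isNilpotent_taylorExpansion_sub (p : MvPolynomial σ k) :
    IsNilpotent (Ideal.Quotient.mk (taylorIdeal f A n) (taylorExpansion k A p) -
      Ideal.Quotient.mk (taylorIdeal f A n) (C (algebraMap (MvPolynomial σ k) A p))) := by
  refine ⟨n + 1, ?_⟩
  rw [← map_sub, ← map_pow, Ideal.Quotient.eq_zero_iff_mem]
  exact Ideal.mem_sup_left (Ideal.pow_mem_pow (taylorExpansion_sub_C_mem k A p) _)

/-- The Taylor expansion on `k[x] / (f)`. -/
noncomputable def quotientTaylor :
    (MvPolynomial σ k ⧸ Ideal.span {f}) →ₐ[k] MvPolynomial σ A ⧸ taylorIdeal f A n :=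
  Ideal.Quotient.liftₐ _ ((Ideal.Quotient.mkₐ k (taylorIdeal f A n)).comp (taylorExpansion k A))
    fun p hp => by
      obtain ⟨q, rfl⟩ := Ideal.mem_span_singleton'.1 hp
      rw [AlgHom.comp_apply, Ideal.Quotient.mkₐ_eq_mk, Ideal.Quotient.eq_zero_iff_mem, map_mul]
      exact Ideal.mul_mem_left _ _ (Ideal.mem_sup_right (Ideal.mem_span_singleton_self _))

variable (M : Submonoid (MvPolynomial σ k ⧸ Ideal.span {f}))
  [Algebra (MvPolynomial σ k ⧸ Ideal.span {f}) A]
  [IsScalarTower (MvPolynomial σ k) (MvPolynomial σ k ⧸ Ideal.span {f}) A]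
 [IsLocalization M A]

theorem isUnit_quotientTaylor (r : M) : IsUnit (quotientTaylor f A n r) := by
  obtain ⟨p, hp⟩ := Ideal.Quotient.mk_surjective r.1
  have h1 : IsUnit (algebraMap (MvPolynomial σ k) A p) := by
    rw [IsScalarTower.algebraMap_apply _ (MvPolynomial σ k ⧸ Ideal.span {f}) A]
    exact IsLocalization.map_units A (⟨_, hp ▸ r.2⟩ : M)
  have h2 := (isNilpotent_taylorExpansion_sub f A n p).isUnit_add_left_of_commute
    ((h1.map C).map (Ideal.Quotient.mk (taylorIdeal f A n))) (Commute.all _ _)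
  rw [add_sub_cancel] at h2
  rw [← hp]
  exact h2

variable [IsScalarTower k (MvPolynomial σ k ⧸ Ideal.span {f}) A]

/-- The Taylor expansion on the localization `A` of `k[x] / (f)`. -/
noncomputable def localTaylor : A →ₐ[k] MvPolynomial σ A ⧸ taylorIdeal f A n :=
  IsLocalization.liftAlgHom (M := M) (f := quotientTaylor f A n) (isUnit_quotientTaylor f A n M)

theorem localTaylor_algebraMap (p : MvPolynomial σ k) :
    localTaylor f A n M (algebraMap (MvPolynomial σ k) A p) =
      Ideal.Quotient.mk (taylorIdeal f A n) (taylorExpansion k A p) := by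
  rw [IsScalarTower.algebraMap_apply _ (MvPolynomial σ k ⧸ Ideal.span {f}) A]
  simp only [localTaylor, IsLocalization.coe_liftAlgHom, IsLocalization.lift_eq]
  rfl

/-- Modulo `(Y)` the two algebra maps agree on the variables, hence on all of `A`. Consequently `I`
is sent into `(Y)`, and `I ^ (n + 1)` to zero. -/
theorem localTaylor_sub_algebraMap_mem (a : A) :
    localTaylor f A n M a - algebraMap A _ a ∈
      (idealOfVars σ A).map (Ideal.Quotient.mk (taylorIdeal f A n)) := by
  suffices h : (Ideal.Quotient.mkₐ k ((idealOfVars σ A).map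
      (Ideal.Quotient.mk (taylorIdeal f A n)))).comp (localTaylor f A n M) =
      (Ideal.Quotient.mkₐ k ((idealOfVars σ A).map (Ideal.Quotient.mk (taylorIdeal f A n)))).comp
        (IsScalarTower.toAlgHom k A _) from
    (Ideal.Quotient.eq).1 (DFunLike.congr_fun h a)
  refine IsLocalization.algHom_ext M (Ideal.Quotient.algHom_ext _ ?_)
  ext p
  refine Ideal.Quotient.eq.2 ?_
  have h := Ideal.mem_map_of_mem (Ideal.Quotient.mk (taylorIdeal f A n))
    (taylorExpansion_sub_C_mem k A (X p : MvPolynomial σ k))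
  rw [map_sub, ← localTaylor_algebraMap f A n M] at h
  have e : algebraMap (MvPolynomial σ k ⧸ Ideal.span {f}) A (Ideal.Quotient.mk _ (X p)) =
      algebraMap (MvPolynomial σ k) A (X p) :=
    (IsScalarTower.algebraMap_apply (MvPolynomial σ k) (MvPolynomial σ k ⧸ Ideal.span {f}) A _).symm
  rw [← e] at h
  exact h

/-- The Taylor expansion on principal parts: `a ⊗ b ↦ a * b(x + Y)`. -/
noncomputable def principalPartsTaylor :
    PrincipalParts k A n →ₐ[A] MvPolynomial σ A ⧸ taylorIdeal f A n :=
  Ideal.Quotient.liftₐ _ (Algebra.TensorProduct.lift (Algebra.ofId A _) (localTaylor f A n M)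
    fun _ _ => Commute.all _ _) <| by
    have h : KaehlerDifferential.ideal k A ≤ ((idealOfVars σ A).map
        (Ideal.Quotient.mk (taylorIdeal f A n))).comap
          (Algebra.TensorProduct.lift (Algebra.ofId A _) (localTaylor f A n M)
            fun _ _ => Commute.all _ _) := by
      rw [← KaehlerDifferential.span_range_eq_ideal, Ideal.span_le]
      rintro _ ⟨a, rfl⟩
      simp only [SetLike.mem_coe, Ideal.mem_comap, map_sub, Algebra.TensorProduct.lift_tmul,
        map_one, one_mul, mul_one]
      exact localTaylor_sub_algebraMap_mem f A n M a
    intro x hx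
    have hx' := (Ideal.pow_right_mono h _).trans (Ideal.le_comap_pow _ _) hx
    rw [← Ideal.map_pow, Ideal.map_mk_eq_bot_of_le le_sup_left] at hx'
    exact hx'

theorem principalPartsTaylor_inr (a : A) :
    principalPartsTaylor f A n M (PrincipalParts.inr k A n a) = localTaylor f A n M a := by
  refine (Algebra.TensorProduct.lift_tmul (Algebra.ofId A _) (localTaylor f A n M)
    (fun _ _ => Commute.all _ _) 1 a).trans ?_
  rw [map_one, one_mul]

/-- The principal parts of a localized hypersurface are `A[Y] / ((Y) ^ (n + 1) + (f(x + Y)))`. -/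
noncomputable def taylorQuotientEquiv :
    (MvPolynomial σ A ⧸ taylorIdeal f A n) ≃ₐ[A] PrincipalParts k A n :=
  have hf : algebraMap (MvPolynomial σ k) A f = 0 := by
    rw [IsScalarTower.algebraMap_apply _ (MvPolynomial σ k ⧸ Ideal.span {f}) A,
      Ideal.Quotient.algebraMap_eq, Ideal.Quotient.mk_singleton_self, map_zero]
  AlgEquiv.ofAlgHom
    (Ideal.Quotient.liftₐ _ (evalPrincipalParts A n) fun _ hx => taylorIdeal_le_ker n hf hx)
    (principalPartsTaylor f A n M)
    -- Both composites are compared with the identity on generators: the elements `inr a`, reduced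
    -- to the `x_i` through the localization and the quotient, and then the `Y_i`.
    (PrincipalParts.algHom_ext fun a => by
      suffices h : (((Ideal.Quotient.liftₐ (taylorIdeal f A n) (evalPrincipalParts A n)
          fun _ hx => taylorIdeal_le_ker n hf hx).restrictScalars k).comp (localTaylor f A n M)) =
          PrincipalParts.inr k A n by
        rw [AlgHom.comp_apply, principalPartsTaylor_inr]
        exact DFunLike.congr_fun h a
      refine IsLocalization.algHom_ext M (Ideal.Quotient.algHom_ext _ ?_)
      ext p
      have e : algebraMap (MvPolynomial σ k ⧸ Ideal.span {f}) A (Ideal.Quotient.mk _ (X p)) =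
          algebraMap (MvPolynomial σ k) A (X p) :=
        (IsScalarTower.algebraMap_apply _ (MvPolynomial σ k ⧸ Ideal.span {f}) A _).symm
      change Ideal.Quotient.liftₐ (taylorIdeal f A n) (evalPrincipalParts A n)
        (fun _ hx => taylorIdeal_le_ker n hf hx) (localTaylor f A n M (algebraMap _ A (Ideal.Quotient.mk _ (X p)))) =
        PrincipalParts.inr k A n (algebraMap _ A (Ideal.Quotient.mk _ (X p)))
      rw [e, localTaylor_algebraMap]
      exact evalPrincipalParts_taylorExpansion A n (X p))
    (by
      refine Ideal.Quotient.algHom_ext _ ?_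
      ext i
      change principalPartsTaylor f A n M (evalPrincipalParts A n (X i)) =
        Ideal.Quotient.mk _ (X i)
      rw [evalPrincipalParts, aeval_X, map_sub, principalPartsTaylor_inr, localTaylor_algebraMap,
        taylorExpansion_X, map_add, AlgHom.commutes]
      exact add_sub_cancel_left _ _)

end Hypersurface

/-! ### The free resolution of length one. -/

section Resolution

open MvPolynomial CategoryTheory

variable {σ : Type} {k : Type u} [CommRing k] (f : MvPolynomial σ k) (A : Type u) [CommRing A]
  [Algebra k A] [Algebra (MvPolynomial σ k) A] [IsScalarTower k (MvPolynomial σ k) A] (n : ℕ)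

section

variable {f A}

theorem taylorExpansion_mem (hf : algebraMap (MvPolynomial σ k) A f = 0) :
    taylorExpansion k A f ∈ idealOfVars σ A := by
  simpa [hf] using taylorExpansion_sub_C_mem k A f

/-- Multiplication by `f(x + Y)`, as a map `A[Y] / (Y) ^ n → A[Y] / (Y) ^ (n + 1)`. -/
noncomputable def mulTaylor (hf : algebraMap (MvPolynomial σ k) A f = 0) :
    (MvPolynomial σ A ⧸ idealOfVars σ A ^ n) →ₗ[A] MvPolynomial σ A ⧸ idealOfVars σ A ^ (n + 1) :=
  (Submodule.mapQ (idealOfVars σ A ^ n) (idealOfVars σ A ^ (n + 1))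
    (LinearMap.mulLeft (MvPolynomial σ A) (taylorExpansion k A f)) fun p hp => by
      -- `F` lies in `(Y)`, so it carries `(Y) ^ n` into `(Y) ^ (n + 1)`; hence the exponents of
      -- source and target differ by one.
      rw [Submodule.mem_comap, LinearMap.mulLeft_apply, pow_succ']
      exact Ideal.mul_mem_mul (taylorExpansion_mem hf) hp).restrictScalars A

theorem mulTaylor_mk (hf : algebraMap (MvPolynomial σ k) A f = 0) (p : MvPolynomial σ A) :
    mulTaylor n hf (Ideal.Quotient.mk _ p) = Ideal.Quotient.mk _ (taylorExpansion k A f * p) := rfl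

theorem mulTaylor_injective [IsDomain A] (hf : algebraMap (MvPolynomial σ k) A f = 0) {j : σ}
    (hj : algebraMap (MvPolynomial σ k) A (pderiv j f) ≠ 0) :
    Function.Injective (mulTaylor n hf) := by
  rw [injective_iff_map_eq_zero]
  intro q hq
  obtain ⟨p, rfl⟩ := Ideal.Quotient.mk_surjective q
  rw [mulTaylor_mk, Ideal.Quotient.eq_zero_iff_mem] at hq
  rw [Ideal.Quotient.eq_zero_iff_mem]
  exact mem_pow_idealOfVars_of_mul_mem (by rwa [coeff_single_taylorExpansion]) hq

theorem pow_idealOfVars_le_taylorIdeal : idealOfVars σ A ^ (n + 1) ≤ taylorIdeal f A n :=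
  le_sup_left

theorem mulTaylor_exact (hf : algebraMap (MvPolynomial σ k) A f = 0) :
    Function.Exact (mulTaylor n hf) (Ideal.Quotient.factorₐ A
      (pow_idealOfVars_le_taylorIdeal (f := f) (A := A) n)).toLinearMap := by
  intro q
  obtain ⟨p, rfl⟩ := Ideal.Quotient.mk_surjective q
  change Ideal.Quotient.mk (taylorIdeal f A n) p = 0 ↔ _
  rw [Ideal.Quotient.eq_zero_iff_mem]
  constructor
  · intro hp
    obtain ⟨a, ha, b, hb, rfl⟩ := Submodule.mem_sup.1 hp
    obtain ⟨c, rfl⟩ := Ideal.mem_span_singleton.1 hb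
    refine ⟨Ideal.Quotient.mk _ c, ?_⟩
    rw [mulTaylor_mk, Ideal.Quotient.eq, ← Ideal.neg_mem_iff]
    simpa using ha
  · rintro ⟨q, hq⟩
    obtain ⟨c, rfl⟩ := Ideal.Quotient.mk_surjective q
    rw [mulTaylor_mk, Ideal.Quotient.eq, ← Ideal.neg_mem_iff] at hq
    have := add_mem (Ideal.mem_sup_left hq : _ ∈ taylorIdeal f A n)
      (Ideal.mem_sup_right (Ideal.mul_mem_right c _ (Ideal.mem_span_singleton_self _)))
    rwa [neg_sub, sub_add_cancel] at this

end

variable (M : Submonoid (MvPolynomial σ k ⧸ Ideal.span {f}))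
  [Algebra (MvPolynomial σ k ⧸ Ideal.span {f}) A]
  [IsScalarTower (MvPolynomial σ k) (MvPolynomial σ k ⧸ Ideal.span {f}) A]
  [IsScalarTower k (MvPolynomial σ k ⧸ Ideal.span {f}) A] [IsLocalization M A]

/-- The quotient map from `A[Y] / (Y) ^ (n + 1)` to the principal parts. -/
noncomputable def toPrincipalPartsOfLocalization :
    (MvPolynomial σ A ⧸ idealOfVars σ A ^ (n + 1)) →ₗ[A] PrincipalParts k A n :=
  (taylorQuotientEquiv f A n M).toLinearMap ∘ₗ
    (Ideal.Quotient.factorₐ A (pow_idealOfVars_le_taylorIdeal (f := f) (A := A) n)).toLinearMap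

theorem toPrincipalPartsOfLocalization_surjective :
    Function.Surjective (toPrincipalPartsOfLocalization f A n M) :=
  (taylorQuotientEquiv f A n M).surjective.comp
    (Ideal.Quotient.factor_surjective (pow_idealOfVars_le_taylorIdeal n))

theorem mulTaylor_exact_toPrincipalPartsOfLocalization
    (hf : algebraMap (MvPolynomial σ k) A f = 0) :
    Function.Exact (mulTaylor n hf) (toPrincipalPartsOfLocalization f A n M) :=
  (mulTaylor_exact n hf).comp_injective _ (taylorQuotientEquiv f A n M).injective (map_zero _)

include M in
theorem UniversalModule.finite_of_isLocalization [Finite σ] :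
    Module.Finite A (UniversalModule k A n) :=
  have : Module.Finite A (PrincipalParts k A n) :=
    Module.Finite.of_surjective _ (toPrincipalPartsOfLocalization_surjective f A n M)
  Module.Finite.of_surjective (ofPrincipalParts k A n) fun x =>
    ⟨_, LinearMap.congr_fun (ofPrincipalParts_comp_toPrincipalParts k A n) x⟩

/-- The resolution `0 → A[Y] / (Y) ^ n → A[Y] / (Y) ^ (n + 1) → P_n(A) → 0`. -/
noncomputable def principalPartsShortComplex (hf : algebraMap (MvPolynomial σ k) A f = 0) :
    ShortComplex (ModuleCat.{u} A) :=
  ShortComplex.mk (ModuleCat.ofHom (mulTaylor n hf))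
    (ModuleCat.ofHom (toPrincipalPartsOfLocalization f A n M)) <| by
    rw [← ModuleCat.ofHom_comp,
      (mulTaylor_exact_toPrincipalPartsOfLocalization f A n M hf).linearMap_comp_eq_zero]
    rfl

theorem shortExact_principalPartsShortComplex [IsDomain A]
    (hf : algebraMap (MvPolynomial σ k) A f = 0) {j : σ}
    (hj : algebraMap (MvPolynomial σ k) A (pderiv j f) ≠ 0) :
    (principalPartsShortComplex f A n M hf).ShortExact where
  exact := by
    rw [ShortComplex.ShortExact.moduleCat_exact_iff_function_exact]
    exact mulTaylor_exact_toPrincipalPartsOfLocalization f A n M hf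
  mono_f := (ModuleCat.mono_iff_injective _).2 (mulTaylor_injective n hf hj)
  epi_g := (ModuleCat.epi_iff_surjective _).2
    (toPrincipalPartsOfLocalization_surjective f A n M)

include M in
theorem UniversalModule.hasProjectiveDimensionLE_one [IsDomain A] {j : σ}
    (hj : algebraMap (MvPolynomial σ k) A (pderiv j f) ≠ 0) :
    HasProjectiveDimensionLE (ModuleCat.of A (UniversalModule k A n)) 1 := by
  have hf : algebraMap (MvPolynomial σ k) A f = 0 := by
    rw [IsScalarTower.algebraMap_apply _ (MvPolynomial σ k ⧸ Ideal.span {f}) A,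
      Ideal.Quotient.algebraMap_eq, Ideal.Quotient.mk_singleton_self, map_zero]
  have h1 : Projective (ModuleCat.of A (MvPolynomial σ A ⧸ idealOfVars σ A ^ n)) :=
    (IsProjective.iff_projective _).1 inferInstance
  have h2 : Projective (ModuleCat.of A (MvPolynomial σ A ⧸ idealOfVars σ A ^ (n + 1))) :=
    (IsProjective.iff_projective _).1 inferInstance
  have h : HasProjectiveDimensionLT (ModuleCat.of A (PrincipalParts k A n)) 2 :=
    (shortExact_principalPartsShortComplex f A n M hf hj).hasProjectiveDimensionLT_X₃ 1
      (projective_iff_hasProjectiveDimensionLT_one.1 h1)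
      (have := projective_iff_hasProjectiveDimensionLT_one.1 h2
       hasProjectiveDimensionLT_of_ge (ModuleCat.of A _) 1 2 (by simp))
  -- Dimension less than `2` means at most `1`, and it is inherited by retracts.
  exact Retract.hasProjectiveDimensionLT (Y := ModuleCat.of A (PrincipalParts k A n))
    { i := ModuleCat.ofHom (toPrincipalParts k A n)
      r := ModuleCat.ofHom (ofPrincipalParts k A n)
      retract := by
        rw [← ModuleCat.ofHom_comp, ofPrincipalParts_comp_toPrincipalParts]
        rfl } 2

end Resolution

/-! ### Finiteness and vanishing of the Betti numbers. -/

section BettiSeries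

open CategoryTheory

variable (A : Type u) [CommRing A] [IsLocalRing A] (M : Type u) [AddCommGroup M] [Module A M]

instance isScalarTower_residueExt (i : ℕ) :
    IsScalarTower A (IsLocalRing.ResidueField A) (ResidueExt A M i) :=
  ⟨fun a r x => by
    obtain ⟨b, rfl⟩ := IsLocalRing.residue_surjective r
    rw [Algebra.smul_def, mul_smul]
    rfl⟩

theorem finite_residueExt [IsNoetherianRing A] [Module.Finite A M] (i : ℕ) :
    Module.Finite (IsLocalRing.ResidueField A) (ResidueExt A M i) := by
  have : Module.Finite A (ModuleCat.of A (IsLocalRing.ResidueField A)) :=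
    inferInstanceAs (Module.Finite A (IsLocalRing.ResidueField A))
  have : Module.Finite A (ModuleCat.of A M) := inferInstanceAs (Module.Finite A M)
  have : Module.Finite A (ResidueExt A M i) :=
    ModuleCat.finite_ext A (ModuleCat.of A M) (ModuleCat.of A (IsLocalRing.ResidueField A)) i
  exact Module.Finite.of_restrictScalars_finite A _ _

theorem exists_bettiSeries_eq_coe_of_hasProjectiveDimensionLE (d : ℕ)
    [HasProjectiveDimensionLE (ModuleCat.of A M) d] :
    ∃ P : Polynomial ℚ, P.natDegree ≤ d ∧ bettiSeries A M = (P : PowerSeries ℚ) := by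
  -- Truncation at `d + 1` keeps the coefficients of index at most `d`; the others vanish with
  -- `Ext`.
  refine ⟨PowerSeries.trunc (d + 1) (bettiSeries A M),
    Nat.lt_succ_iff.1 (PowerSeries.natDegree_trunc_lt _ _), ?_⟩
  ext i
  rw [Polynomial.coeff_coe, PowerSeries.coeff_trunc]
  split_ifs with hi
  · rfl
  · have : Subsingleton (ResidueExt A M i) :=
      HasProjectiveDimensionLT.subsingleton (ModuleCat.of A M) (d + 1) i (not_lt.1 hi) _
    rw [bettiSeries, PowerSeries.coeff_mk, Module.finrank_zero_of_subsingleton, Nat.cast_zero]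

end BettiSeries

theorem isRationalSeries_coe (P : Polynomial ℚ) : IsRationalSeries (P : PowerSeries ℚ) :=
  ⟨P, 1, one_ne_zero, by simp⟩

theorem mainTheorem2 {k : Type u} [Field k] [IsAlgClosed k] [CharZero k] (s n : ℕ) (hn : 1 ≤ n)
    (f : MvPolynomial (Fin s) k) (hirr : Irreducible f)
    (m : Ideal (MvPolynomial (Fin s) k)) [m.IsMaximal] (hfm : f ∈ m)
    (hd : ∀ α : Fin s →₀ ℕ, α.degree ≤ n - 1 →
      UniversalModule.d k (MvPolynomial (Fin s) k) n (MvPolynomial.monomial α 1 * f) ∈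
        m • (⊤ : Submodule (MvPolynomial (Fin s) k)
          (UniversalModule k (MvPolynomial (Fin s) k) n)))
    (hsing : ¬ IsRegularLocalRing (HypersurfaceLocalRing f m hfm)) :
    (∀ i : ℕ, Module.Finite (IsLocalRing.ResidueField (HypersurfaceLocalRing f m hfm))
      (ResidueExt (HypersurfaceLocalRing f m hfm)
        (UniversalModule k (HypersurfaceLocalRing f m hfm) n) i)) ∧
    IsRationalSeries (bettiSeries (HypersurfaceLocalRing f m hfm)
      (UniversalModule k (HypersurfaceLocalRing f m hfm) n)) ∧
    ∃ P : Polynomial ℚ, P.natDegree ≤ 1 ∧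
      bettiSeries (HypersurfaceLocalRing f m hfm)
        (UniversalModule k (HypersurfaceLocalRing f m hfm) n) = (P : PowerSeries ℚ) := by
  have : (quotientIdeal f m).IsPrime := quotientIdeal_isPrime hfm
  have : (Ideal.span {f}).IsPrime :=
    (Ideal.span_singleton_prime hirr.ne_zero).2 hirr.prime
  have hle : (quotientIdeal f m).primeCompl ≤ nonZeroDivisors _ :=
    Ideal.primeCompl_le_nonZeroDivisors _
  have : IsDomain (HypersurfaceLocalRing f m hfm) :=
    IsLocalization.isDomain_of_le_nonZeroDivisors _ hle
  have : IsNoetherianRing (HypersurfaceLocalRing f m hfm) :=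
    IsLocalization.isNoetherianRing (quotientIdeal f m).primeCompl _ inferInstance
  -- The derivative is nonzero in the domain `S / (f)`, and stays so in the localization, which is
  -- injective there.
  obtain ⟨j, hj⟩ := MvPolynomial.exists_not_dvd_pderiv hirr
  have hj' : algebraMap (MvPolynomial (Fin s) k) (HypersurfaceLocalRing f m hfm)
      (MvPolynomial.pderiv j f) ≠ 0 := by
    rw [IsScalarTower.algebraMap_apply _ (MvPolynomial (Fin s) k ⧸ Ideal.span {f})]
    refine fun h => hj ?_
    rw [← Ideal.mem_span_singleton, ← Ideal.Quotient.eq_zero_iff_mem]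
    exact IsLocalization.injective _ hle (h.trans (map_zero _).symm)
  have : Module.Finite (HypersurfaceLocalRing f m hfm)
      (UniversalModule k (HypersurfaceLocalRing f m hfm) n) :=
    UniversalModule.finite_of_isLocalization f _ n (quotientIdeal f m).primeCompl
  have := UniversalModule.hasProjectiveDimensionLE_one f (HypersurfaceLocalRing f m hfm) n
    (quotientIdeal f m).primeCompl hj'
  have hP := exists_bettiSeries_eq_coe_of_hasProjectiveDimensionLE (HypersurfaceLocalRing f m hfm)
    (UniversalModule k (HypersurfaceLocalRing f m hfm) n) 1
  refine ⟨finite_residueExt _ _, ?_, hP⟩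
  obtain ⟨P, -, hP⟩ := hP
  rw [hP]
  exact isRationalSeries_coe P
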